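/- Let $G$ be a totally disconnected, locally compact topological group (not necessarily metrizable) and let $\alpha$ be an automorphism of the topological group $G$. For a topological group $L$ and an automorphism $\beta$ of $L$, a compact open subgroup $V\subseteq L$ is called tidy for $\beta$ if $V=V_+V_-$, where $V_{\pm}:=\bigcap_{n\ge 0}\beta^{\pm n}(V)$, and if both $V_{++}:=\bigcup_{n\ge 0}\beta^{n}(V_+)$ and $V_{--}:=\bigcup_{n\ge 0}\beta^{-n}(V_-)$ are closed in $L$; the automorphism $\beta$ is called tidy if every identity neighbourhood of $L$ contains a subgroup tidy for $\beta$. Let $M_\alpha:=\{x\in G : \{\alpha^n(x):n\in\mathbb Z\}\text{ is relatively compact in }G\}$, which is an $\alpha$-stable subgroup of $G$, and let $U_\alpha:=\{x\in G:\lim_{n\to\infty}\alpha^n(x)=1\}$. For a subset $H\subseteq G$, let $U_{\alpha/H}$ be the set of all $x\in G$ such that for every identity neighbourhood $V\subseteq G$ there exists $N\in\mathbb N$ with $\alpha^n(x)\in VH$ for all $n\ge N$. Let $H$ be a closed subgroup of $G$ with $\alpha(H)=H$. If the restriction $\alpha|_{M_\alpha}$ of $\alpha$ to $M_\alpha$ (with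 the subspace topology) is tidy, then $$U_{\alpha/H}=U_\alpha H.$$ -/

import Mathlib

open Filter Topology
open scoped Pointwise

namespace TidyAut

section Defs

variable {G : Type*} [Group G] [TopologicalSpace G]

/-- The integer power `α ^ n` of a topological group automorphism, as a group automorphism. -/
def iter (α : G ≃ₜ* G) (n : ℤ) : MulAut G :=
  (α.toMulEquiv : MulAut G) ^ n

/-- `H` is `α`-stable: `α(H) = H`. -/
def IsStable (α : G ≃ₜ* G) (H : Subgroup G) : Prop :=
  H.map (α.toMulEquiv.toMonoidHom) = H

theorem IsStable.apply_mem {α : G ≃ₜ* G} {H : Subgroup G} (h : IsStable α H) {x : G}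
    (hx : x ∈ H) : α x ∈ H := by
  have h1 : α x ∈ H.map (α.toMulEquiv.toMonoidHom) := ⟨x, hx, rfl⟩
  rwa [h] at h1

theorem IsStable.symm_apply_mem {α : G ≃ₜ* G} {H : Subgroup G} (h : IsStable α H) {x : G}
    (hx : x ∈ H) : α.symm x ∈ H := by
  rw [← h] at hx
  obtain ⟨y, hy, rfl⟩ := hx
  have : α.symm (α y) = y := α.symm_apply_apply y
  exact this.symm ▸ hy

/-- The restriction `α|_H` of `α` to an `α`-stable subgroup `H` (with the subspace topology). -/
def restrict (α : G ≃ₜ* G) (H : Subgroup G) (h : IsStable α H) : H ≃ₜ* H where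
  toFun x := ⟨α x, h.apply_mem x.2⟩
  invFun x := ⟨α.symm x, h.symm_apply_mem x.2⟩
  left_inv x := Subtype.ext (α.symm_apply_apply x)
  right_inv x := Subtype.ext (α.apply_symm_apply x)
  map_mul' x y := Subtype.ext (map_mul α (x : G) (y : G))
  continuous_toFun := (α.continuous.comp continuous_subtype_val).subtype_mk _
  continuous_invFun := (α.symm.continuous.comp continuous_subtype_val).subtype_mk _

/-- `V₊ = ⋂_{n ≥ 0} αⁿ(V)`. -/
def plus (α : G ≃ₜ* G) (V : Subgroup G) : Subgroup G :=
  ⨅ n : ℕ, V.map (iter α n).toMonoidHom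

/-- `V₋ = ⋂_{n ≥ 0} α⁻ⁿ(V)`. -/
def minus (α : G ≃ₜ* G) (V : Subgroup G) : Subgroup G :=
  ⨅ n : ℕ, V.map (iter α (-n)).toMonoidHom

/-- `V₊₊ = ⋃_{n ≥ 0} αⁿ(V₊)`. -/
def plusPlus (α : G ≃ₜ* G) (V : Subgroup G) : Set G :=
  ⋃ n : ℕ, iter α n '' (plus α V : Set G)

/-- `V₋₋ = ⋃_{n ≥ 0} α⁻ⁿ(V₋)`. -/
def minusMinus (α : G ≃ₜ* G) (V : Subgroup G) : Set G :=
  ⋃ n : ℕ, iter α (-n) '' (minus α V : Set G)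

/-- A compact open subgroup `V` is tidy for `α` if `V = V₊V₋` and `V₊₊`, `V₋₋` are closed. -/
structure IsTidySubgroup (α : G ≃ₜ* G) (V : Subgroup G) : Prop where
  isCompact : IsCompact (V : Set G)
  isOpen : IsOpen (V : Set G)
  eq_mul : (V : Set G) = (plus α V : Set G) * (minus α V : Set G)
  isClosed_plusPlus : IsClosed (plusPlus α V)
  isClosed_minusMinus : IsClosed (minusMinus α V)

/-- `α` is tidy: there are arbitrarily small subgroups tidy for `α`. -/
def IsTidy (α : G ≃ₜ* G) : Prop :=
  ∀ Y ∈ 𝓝 (1 : G), ∃ V : Subgroup G, IsTidySubgroup α V ∧ (V : Set G) ⊆ Y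

/-- The contraction group `U_α`, as a subset of `G`. -/
def contractionSet (α : G ≃ₜ* G) : Set G :=
  {x | Tendsto (fun n : ℕ => iter α n x) atTop (𝓝 1)}

/-- The set `U_{α/H}` of all `x` with `lim αⁿ(x) = 1 mod H`: for each identity neighbourhood `V`,
eventually `αⁿ(x) ∈ VH`. -/
def contractionSetMod (α : G ≃ₜ* G) (H : Set G) : Set G :=
  {x | ∀ V ∈ 𝓝 (1 : G), ∃ N : ℕ, ∀ n : ℕ, N ≤ n → iter α n x ∈ V * H}

variable [IsTopologicalGroup G]

/-- The Levi factor `M_α`: all `x` whose two-sided orbit `{αⁿ(x) : n ∈ ℤ}` is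
relatively compact. -/
def levi (α : G ≃ₜ* G) : Subgroup G where
  carrier := {x | IsCompact (closure (Set.range fun n : ℤ => iter α n x))}
  one_mem' := by
    refine isCompact_singleton.closure_of_subset (K := {(1 : G)}) ?_
    rintro _ ⟨n, rfl⟩
    simp
  mul_mem' := by
    intro x y hx hy
    refine (IsCompact.mul hx hy).closure_of_subset ?_
    rintro _ ⟨n, rfl⟩
    refine ⟨iter α n x, subset_closure ⟨n, rfl⟩, iter α n y, subset_closure ⟨n, rfl⟩, ?_⟩
    simp
  inv_mem' := by
    intro x hx
    refine (IsCompact.inv hx).closure_of_subset ?_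
    rintro _ ⟨n, rfl⟩
    rw [Set.mem_inv]
    refine subset_closure ⟨n, ?_⟩
    simp

theorem mem_levi {α : G ≃ₜ* G} {x : G} :
    x ∈ levi α ↔ IsCompact (closure (Set.range fun n : ℤ => iter α n x)) :=
  Iff.rfl

/-- `M_α` is `α`-stable. -/
theorem isStable_levi (α : G ≃ₜ* G) : IsStable α (levi α) := by
  have key : ∀ x : G, (Set.range fun n : ℤ => iter α n (α x)) =
      Set.range fun n : ℤ => iter α n x := by
    intro x
    have h : ∀ n : ℤ, iter α n (α x) = iter α (n + 1) x := by
      intro n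
      simp only [iter, zpow_add, zpow_one, MulAut.mul_apply]
      rfl
    simp only [h]
    exact (Equiv.addRight (1 : ℤ)).surjective.range_comp (fun n : ℤ => iter α n x)
  have hiff : ∀ x : G, α x ∈ levi α ↔ x ∈ levi α := by
    intro x
    rw [mem_levi, mem_levi, key]
  apply le_antisymm
  · rintro _ ⟨x, hx, rfl⟩
    exact (hiff x).2 hx
  · intro x hx
    have hs : α (α.symm x) = x := α.apply_symm_apply x
    exact ⟨α.symm x, (hiff _).1 (hs.symm ▸ hx), hs⟩

end Defs

end TidyAut

/-!
If `αⁿ(x) = vₙhₙ` with `vₙ → 1` and `hₙ ∈ H`, then `vₙ₊₁⁻¹ α(vₙ) ∈ H` tends to `1`, so `(vₙ)` is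
eventually a pseudo-orbit with errors in `H`. Shrinking a compact open subgroup `V ∩ H` of `H` to
some `B` which is tidy above makes the pseudo-orbit shadowed by a true orbit: `αⁿ(xh) ∈ vₙB` for
some `h ∈ H` and all large `n`. Hence `αⁿ(xh)` eventually stays in the compact open subgroup `V`,
and its limit points lie in the compact stable subgroup `K = ⋂ₙ αⁿ(V ∩ H)`, which reduces the
modulus from `H` to `K`.

Since `K ⊆ M_α` and, by a Baire argument, tidy subgroups of `M_α` are stable, `K` has arbitrarily
small stable relatively open subgroups `W`. These are tidy above in `K`, so by the shadowing again
some `k ∈ K` has `αⁿ(xhk) ∈ VW` for large `n`. For each `V` and `W` such `k` form a closed set, and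
compactness of `K` gives a `k` which works for all `V` and `W`.
-/

namespace TidyAut

section Iterates

variable {G : Type*} [Group G] [TopologicalSpace G] {α : G ≃ₜ* G} {H K V : Subgroup G}

theorem iter_add_apply (α : G ≃ₜ* G) (m n : ℤ) (x : G) :
    iter α (m + n) x = iter α m (iter α n x) := by
  simp only [iter, zpow_add, MulAut.mul_apply]

@[simp]
theorem iter_zero_apply (α : G ≃ₜ* G) (x : G) : iter α 0 x = x := by
  simp only [iter, zpow_zero, MulAut.one_apply]

theorem iter_one_apply (α : G ≃ₜ* G) (x : G) : iter α 1 x = α x := by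
  rw [iter, zpow_one]
  rfl

theorem iter_symm (α : G ≃ₜ* G) (n : ℤ) : iter α.symm n = iter α (-n) := by
  rw [iter, iter, ← inv_zpow']
  rfl

theorem apply_iter (α : G ≃ₜ* G) (n : ℤ) (x : G) : α (iter α n x) = iter α (n + 1) x := by
  rw [add_comm, iter_add_apply, iter_one_apply]

theorem iter_apply (α : G ≃ₜ* G) (n : ℤ) (x : G) : iter α n (α x) = iter α (n + 1) x := by
  rw [iter_add_apply, iter_one_apply]

theorem symm_apply_iter (α : G ≃ₜ* G) (n : ℤ) (x : G) :
    α.symm (iter α n x) = iter α (n - 1) x := by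
  rw [← iter_one_apply α.symm, iter_symm, ← iter_add_apply, neg_add_eq_sub]

@[simp]
theorem iter_neg_iter (α : G ≃ₜ* G) (n : ℤ) (x : G) : iter α (-n) (iter α n x) = x := by
  rw [← iter_add_apply, neg_add_cancel, iter_zero_apply]

@[simp]
theorem iter_iter_neg (α : G ≃ₜ* G) (n : ℤ) (x : G) : iter α n (iter α (-n) x) = x := by
  rw [← iter_add_apply, add_neg_cancel, iter_zero_apply]

theorem continuous_iter (α : G ≃ₜ* G) (n : ℤ) : Continuous (iter α n) := by
  induction n with
  | zero => exact continuous_id.congr fun x => (iter_zero_apply α x).symm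
  | succ n ih => exact (α.continuous.comp ih).congr (apply_iter α n)
  | pred n ih => exact (α.symm.continuous.comp ih).congr (symm_apply_iter α (-n))

theorem coe_map_iter (α : G ≃ₜ* G) (V : Subgroup G) (n : ℤ) :
    (V.map (iter α n).toMonoidHom : Set G) = iter α (-n) ⁻¹' V := by
  ext x
  refine ⟨?_, fun hx => ⟨_, hx, iter_iter_neg α n x⟩⟩
  rintro ⟨y, hy, rfl⟩
  simpa using hy

theorem mem_map_iter {n : ℤ} {x : G} :
    x ∈ V.map (iter α n).toMonoidHom ↔ iter α (-n) x ∈ V :=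
  Set.ext_iff.1 (coe_map_iter α V n) x

theorem isClosed_map_iter (hV : IsClosed (V : Set G)) (n : ℤ) :
    IsClosed (V.map (iter α n).toMonoidHom : Set G) := by
  rw [coe_map_iter]
  exact hV.preimage (continuous_iter α _)

theorem isStable_iff_apply_mem_iff : IsStable α H ↔ ∀ x, α x ∈ H ↔ x ∈ H := by
  refine ⟨fun h x => ⟨fun hx => ?_, h.apply_mem⟩, fun h => Subgroup.ext fun x => ?_⟩
  · simpa using h.symm_apply_mem hx
  · refine ⟨?_, fun hx => ⟨α.symm x, ?_, α.apply_symm_apply x⟩⟩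
    · rintro ⟨y, hy, rfl⟩
      exact (h y).2 hy
    · exact (h _).1 (by simpa using hx)

theorem IsStable.inf (hH : IsStable α H) (hK : IsStable α K) : IsStable α (H ⊓ K) := by
  simp only [isStable_iff_apply_mem_iff, Subgroup.mem_inf] at hH hK ⊢
  exact fun x => and_congr (hH x) (hK x)

theorem IsStable.iter_mem (hH : IsStable α H) (n : ℤ) {x : G} (hx : x ∈ H) :
    iter α n x ∈ H := by
  induction n with
  | zero => rwa [iter_zero_apply]
  | succ n ih => exact apply_iter α n x ▸ hH.apply_mem ih
  | pred n ih => exact symm_apply_iter α (-n) x ▸ hH.symm_apply_mem ih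

theorem IsStable.map_subtype {hH : IsStable α H} {W : Subgroup H}
    (hW : IsStable (restrict α H hH) W) : IsStable α (W.map H.subtype) := by
  have hW' := congrArg (Subgroup.map H.subtype) hW
  rw [Subgroup.map_map] at hW'
  rwa [IsStable, Subgroup.map_map]

theorem coe_iter_restrict (hH : IsStable α H) (n : ℤ) (x : H) :
    (iter (restrict α H hH) n x : G) = iter α n x := by
  induction n with
  | zero => simp only [iter_zero_apply]
  | succ n ih =>
    rw [← apply_iter, ← apply_iter, ← ih]
    rfl
  | pred n ih =>
    rw [← symm_apply_iter, ← symm_apply_iter, ← ih]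
    rfl

end Iterates

section StableCore

variable {G : Type*} [Group G] [TopologicalSpace G] {α : G ≃ₜ* G} {S : Subgroup G}

/-- The largest `α`-stable subgroup `⋂_{n ∈ ℤ} αⁿ(S)` of `S`, to which orbits that eventually
stay in `S` are attracted. -/
def stableCore (α : G ≃ₜ* G) (S : Subgroup G) : Subgroup G :=
  ⨅ n : ℤ, S.map (iter α n).toMonoidHom

theorem mem_stableCore {x : G} : x ∈ stableCore α S ↔ ∀ n : ℤ, iter α n x ∈ S := by
  simp only [stableCore, Subgroup.mem_iInf, mem_map_iter]
  exact (Equiv.neg ℤ).forall_congr_right (q := fun n => iter α n x ∈ S)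

theorem stableCore_le (α : G ≃ₜ* G) (S : Subgroup G) : stableCore α S ≤ S := fun x hx => by
  simpa using mem_stableCore.1 hx 0

theorem isStable_stableCore (α : G ≃ₜ* G) (S : Subgroup G) : IsStable α (stableCore α S) := by
  simp only [isStable_iff_apply_mem_iff, mem_stableCore, iter_apply]
  exact fun x => (Equiv.addRight (1 : ℤ)).forall_congr_right (q := fun n => iter α n x ∈ S)

theorem isClosed_stableCore (hS : IsClosed (S : Set G)) :
    IsClosed (stableCore α S : Set G) := by
  rw [stableCore, Subgroup.coe_iInf]
  exact isClosed_iInter fun n => isClosed_map_iter hS n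

end StableCore

section Plus

variable {G : Type*} [Group G] [TopologicalSpace G] {α : G ≃ₜ* G} {H V : Subgroup G}

theorem mem_plus {x : G} : x ∈ plus α V ↔ ∀ n : ℕ, iter α (-n) x ∈ V := by
  simp only [plus, Subgroup.mem_iInf, mem_map_iter]

theorem plus_le (α : G ≃ₜ* G) (V : Subgroup G) : plus α V ≤ V := fun x hx => by
  simpa using mem_plus.1 hx 0

theorem isClosed_plus (hV : IsClosed (V : Set G)) : IsClosed (plus α V : Set G) := by
  rw [plus, Subgroup.coe_iInf]
  exact isClosed_iInter fun n => isClosed_map_iter hV n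

theorem iter_mem_plus_of_nonpos {n : ℤ} (hn : n ≤ 0) {x : G} (hx : x ∈ plus α V) :
    iter α n x ∈ plus α V := by
  obtain ⟨k, rfl⟩ := Int.exists_eq_neg_ofNat hn
  rw [mem_plus] at hx ⊢
  intro m
  rw [← iter_add_apply, ← neg_add]
  exact_mod_cast hx (m + k)

theorem plus_symm (α : G ≃ₜ* G) (V : Subgroup G) : plus α.symm V = minus α V := by
  simp only [plus, minus, iter_symm]

theorem plusPlus_symm (α : G ≃ₜ* G) (V : Subgroup G) :
    plusPlus α.symm V = minusMinus α V := by
  simp only [plusPlus, minusMinus, iter_symm, plus_symm]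

theorem IsTidySubgroup.symm (hV : IsTidySubgroup α V) : IsTidySubgroup α.symm V where
  isCompact := hV.isCompact
  isOpen := hV.isOpen
  eq_mul := by
    have h := congrArg (·⁻¹) hV.eq_mul
    simp only [mul_inv_rev, inv_coe_set] at h
    rwa [plus_symm, ← plus_symm α.symm]
  isClosed_plusPlus := plusPlus_symm α V ▸ hV.isClosed_minusMinus
  isClosed_minusMinus := plusPlus_symm α.symm V ▸ hV.isClosed_plusPlus

/-- The finite stage `⋂_{0 ≤ i ≤ k} αⁱ(V)` of the intersection `V₊`. -/
def plusUpTo (α : G ≃ₜ* G) (V : Subgroup G) (k : ℕ) : Subgroup G :=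
  ⨅ i ≤ k, V.map (iter α i).toMonoidHom

theorem mem_plusUpTo {k : ℕ} {x : G} :
    x ∈ plusUpTo α V k ↔ ∀ i : ℕ, i ≤ k → iter α (-i) x ∈ V := by
  simp only [plusUpTo, Subgroup.mem_iInf, mem_map_iter]

theorem plusUpTo_antitone (α : G ≃ₜ* G) (V : Subgroup G) : Antitone (plusUpTo α V) :=
  fun _ _ hkl _ hx => mem_plusUpTo.2 fun i hi => mem_plusUpTo.1 hx i (hi.trans hkl)

theorem plusUpTo_le (α : G ≃ₜ* G) (V : Subgroup G) (k : ℕ) : plusUpTo α V k ≤ V := fun x hx => by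
  simpa using mem_plusUpTo.1 hx 0 k.zero_le

theorem iInf_plusUpTo (α : G ≃ₜ* G) (V : Subgroup G) : ⨅ k, plusUpTo α V k = plus α V := by
  ext x
  simp only [Subgroup.mem_iInf, mem_plusUpTo, mem_plus]
  exact ⟨fun h n => h n n le_rfl, fun h _ i _ => h i⟩

theorem plus_plusUpTo (α : G ≃ₜ* G) (V : Subgroup G) (k : ℕ) :
    plus α (plusUpTo α V k) = plus α V := by
  refine le_antisymm (fun x hx => ?_) fun x hx => ?_
  · exact mem_plus.2 fun n => plusUpTo_le α V k (mem_plus.1 hx n)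
  · refine mem_plus.2 fun n => mem_plusUpTo.2 fun i _ => ?_
    exact mem_plus.1 (iter_mem_plus_of_nonpos (by omega) hx) i

theorem apply_mem_plusUpTo {k : ℕ} {x : G} (hx : x ∈ plusUpTo α V k) (hαx : α x ∈ V) :
    α x ∈ plusUpTo α V k := by
  refine mem_plusUpTo.2 fun i hi => ?_
  cases i with
  | zero => simpa using hαx
  | succ i =>
    rw [iter_apply, Nat.cast_succ, neg_add_rev, neg_add_cancel_comm]
    exact mem_plusUpTo.1 hx i (by omega)

theorem isClosed_plusUpTo (hV : IsClosed (V : Set G)) (k : ℕ) :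
    IsClosed (plusUpTo α V k : Set G) := by
  simp only [plusUpTo, Subgroup.coe_iInf]
  exact isClosed_biInter fun i _ => isClosed_map_iter hV i

theorem plusUpTo_mem_nhdsWithin (hH : IsStable α H) (hV : (V : Set G) ∈ 𝓝[H] 1) (k : ℕ) :
    (plusUpTo α V k : Set G) ∈ 𝓝[H] 1 := by
  simp only [plusUpTo, Subgroup.coe_iInf, coe_map_iter]
  refine (biInter_mem (Set.finite_le_nat k)).2 fun i _ => ?_
  have hmaps : Set.MapsTo (iter α (-i)) H H := fun x hx => hH.iter_mem _ hx
  have hcont := (continuous_iter α (-i)).continuousWithinAt.tendsto_nhdsWithin (x := 1) hmaps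
  rw [map_one] at hcont
  exact hcont hV

end Plus

section IsStableNhd

variable {G : Type*} [Group G] [TopologicalSpace G] {α : G ≃ₜ* G} {K : Subgroup G}

/-- `W` is a relatively open `α`-stable subgroup of `K`. Relative openness is encoded as being a
neighbourhood of `1` within `K`. -/
structure IsStableNhd (α : G ≃ₜ* G) (K W : Subgroup G) : Prop where
  le : W ≤ K
  isStable : IsStable α W
  mem_nhdsWithin : (W : Set G) ∈ 𝓝[K] 1

theorem IsStable.isStableNhd_self (hK : IsStable α K) : IsStableNhd α K K :=
  ⟨le_rfl, hK, self_mem_nhdsWithin⟩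

theorem IsStableNhd.inf {W W' : Subgroup G} (hW : IsStableNhd α K W) (hW' : IsStableNhd α K W') :
    IsStableNhd α K (W ⊓ W') :=
  ⟨inf_le_left.trans hW.le, hW.isStable.inf hW'.isStable,
    inter_mem hW.mem_nhdsWithin hW'.mem_nhdsWithin⟩

end IsStableNhd

section Levi

variable {G : Type*} [Group G] [TopologicalSpace G] [IsTopologicalGroup G] {α : G ≃ₜ* G}
  {K V : Subgroup G}

theorem closure_orbit_subset_levi {x : G} (hx : x ∈ levi α) :
    closure (Set.range fun n : ℤ => iter α n x) ⊆ levi α := by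
  intro y hy
  refine IsCompact.of_isClosed_subset hx isClosed_closure
    (closure_minimal ?_ isClosed_closure)
  rintro _ ⟨m, rfl⟩
  refine map_mem_closure (continuous_iter α m) hy ?_
  rintro _ ⟨n, rfl⟩
  exact ⟨m + n, iter_add_apply α m n x⟩

theorem levi_restrict_levi (α : G ≃ₜ* G) :
    levi (restrict α (levi α) (isStable_levi α)) = ⊤ := by
  refine eq_top_iff.2 fun x _ => ?_
  have hK : IsCompact ((Subtype.val : levi α → G) ⁻¹'
      closure (Set.range fun n : ℤ => iter α n (x : G))) := by
    have himage := Set.image_preimage_eq_of_subset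
      ((closure_orbit_subset_levi x.2).trans (Subtype.range_coe (s := (levi α : Set G))).superset)
    exact IsInducing.subtypeVal.isCompact_iff.2 (himage.symm ▸ x.2)
  refine hK.of_isClosed_subset isClosed_closure
    (closure_minimal ?_ (isClosed_closure.preimage continuous_subtype_val))
  rintro _ ⟨n, rfl⟩
  exact subset_closure ⟨n, (coe_iter_restrict _ n x).symm⟩

theorem levi_symm (α : G ≃ₜ* G) : levi α.symm = levi α := by
  ext x
  simp only [mem_levi, iter_symm]
  rw [← (Equiv.neg ℤ).surjective.range_comp fun n => iter α n x]
  rfl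

theorem IsStable.le_levi (hK : IsStable α K) (hKc : IsCompact (K : Set G)) :
    K ≤ levi α := by
  refine fun x hx => hKc.closure_of_subset ?_
  rintro _ ⟨n, rfl⟩
  exact hK.iter_mem n hx

theorem exists_subset_of_subset_iUnion [LocallyCompactSpace G] {T : ℕ → Subgroup G}
    (hT : Monotone T) (hTc : ∀ m, IsClosed (T m : Set G))
    (hcl : IsClosed (⋃ m, (T m : Set G))) {C : Set G} (hC : IsCompact C)
    (hCT : C ⊆ ⋃ m, (T m : Set G)) : ∃ m, C ⊆ T m := by
  let S : Subgroup G := ⨆ m, T m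
  have hS : (S : Set G) = ⋃ m, (T m : Set G) := Subgroup.coe_iSup_of_directed hT.directed_le
  rw [← hS] at hcl hCT
  have : LocallyCompactSpace S := hcl.isClosedEmbedding_subtypeVal.locallyCompactSpace
  have hcover : ⋃ m, ((T m).subgroupOf S : Set S) = Set.univ :=
    Set.eq_univ_of_forall fun y => by
      simpa only [Set.mem_iUnion, SetLike.mem_coe, Subgroup.mem_subgroupOf] using hS.subset y.2
  obtain ⟨m, y, hy⟩ := nonempty_interior_of_iUnion_of_closed
    (fun m => (hTc m).preimage continuous_subtype_val) hcover
  have hopen : ∀ n, IsOpen ((T (m + n)).subgroupOf S : Set S) := fun n =>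
    Subgroup.isOpen_mono (Subgroup.comap_mono (hT (m.le_add_right n)))
      (Subgroup.isOpen_of_mem_nhds _ (mem_interior_iff_mem_nhds.1 hy))
  have hCS : IsCompact (Subtype.val ⁻¹' C : Set S) :=
    hcl.isClosedEmbedding_subtypeVal.isCompact_preimage hC
  have hCcover : (Subtype.val ⁻¹' C : Set S) ⊆ ⋃ n, ((T (m + n)).subgroupOf S : Set S) :=
    fun y _ => by
      obtain ⟨n, hn⟩ := Set.mem_iUnion.1 (hS.subset y.2)
      exact Set.mem_iUnion.2 ⟨n, hT (n.le_add_left m) hn⟩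
  obtain ⟨n, hn⟩ := hCS.elim_directed_cover _ hopen hCcover
    (Monotone.directed_le fun _ _ hkl => Subgroup.comap_mono (hT (Nat.add_le_add_left hkl m)))
  exact ⟨m + n, fun x hx => hn (show (⟨x, hCT hx⟩ : S) ∈ Subtype.val ⁻¹' C from hx)⟩

/-- If `x` has relatively compact orbit and `V₊₊` is closed, then by Baire the whole orbit of `x`
lies in a single `αᵐ(V₊)`. -/
theorem apply_mem_plus_of_isClosed_plusPlus [LocallyCompactSpace G]
    (hV : IsClosed (V : Set G)) (hcl : IsClosed (plusPlus α V)) {x : G} (hx : x ∈ plus α V)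
    (hxL : x ∈ levi α) : α x ∈ plus α V := by
  let T : ℕ → Subgroup G := fun m => (plus α V).map (iter α m).toMonoidHom
  have hT : Monotone T := monotone_nat_of_le_succ fun m y hy => by
    rw [mem_map_iter] at hy ⊢
    rw [Nat.cast_succ, neg_add_rev, iter_add_apply]
    exact iter_mem_plus_of_nonpos (by omega) hy
  have horbit : Set.range (fun n : ℤ => iter α n x) ⊆ plusPlus α V := by
    rintro _ ⟨n, rfl⟩
    refine Set.mem_iUnion.2 ⟨n.toNat, mem_map_iter.2 ?_⟩
    rw [← iter_add_apply]
    exact iter_mem_plus_of_nonpos (by omega) hx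
  obtain ⟨m, hm⟩ := exists_subset_of_subset_iUnion hT
    (fun m => isClosed_map_iter (isClosed_plus hV) m) hcl hxL (closure_minimal horbit hcl)
  have hmem : iter α (m + 1) x ∈ T m := hm (subset_closure ⟨_, rfl⟩)
  rwa [mem_map_iter, ← iter_add_apply, neg_add_cancel_left, iter_one_apply] at hmem

theorem IsTidySubgroup.apply_mem (hV : IsTidySubgroup α V) (hVL : V ≤ levi α) {x : G}
    (hx : x ∈ V) : α x ∈ V := by
  have : LocallyCompactSpace G := hV.isCompact.locallyCompactSpace_of_mem_nhds_of_group
    (hV.isOpen.mem_nhds (one_mem V))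
  obtain ⟨a, ha, b, hb, rfl⟩ := hV.eq_mul.subset hx
  have hαa : α a ∈ plus α V := apply_mem_plus_of_isClosed_plusPlus
    (Subgroup.isClosed_of_isOpen V hV.isOpen) hV.isClosed_plusPlus ha (hVL (plus_le α V ha))
  have hαb : α b ∈ V := by
    rw [SetLike.mem_coe, ← plus_symm] at hb
    simpa [iter_symm, iter_one_apply] using mem_plus.1 hb 1
  simpa only [map_mul] using mul_mem (plus_le α V hαa) hαb

theorem IsTidySubgroup.isStable (hV : IsTidySubgroup α V) (hVL : V ≤ levi α) :
    IsStable α V := by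
  refine isStable_iff_apply_mem_iff.2 fun x => ⟨fun hx => ?_, hV.apply_mem hVL⟩
  simpa using hV.symm.apply_mem (levi_symm α ▸ hVL) hx

theorem exists_isStableNhd_subset (htidy : IsTidy (restrict α (levi α) (isStable_levi α)))
    (hKc : IsCompact (K : Set G)) (hK : IsStable α K) {Y : Set G} (hY : Y ∈ 𝓝 1) :
    ∃ W : Subgroup G, IsStableNhd α K W ∧ (W : Set G) ⊆ Y := by
  obtain ⟨V, hV, hVY⟩ := htidy (Subtype.val ⁻¹' Y)
    (continuous_subtype_val.continuousAt.preimage_mem_nhds (by simpa using hY))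
  have hVstable : IsStable _ V := hV.isStable (levi_restrict_levi α ▸ le_top)
  have hVKstable := (IsStable.map_subtype hVstable).inf hK
  refine ⟨V.map (levi α).subtype ⊓ K, ⟨inf_le_right, hVKstable, ?_⟩, ?_⟩
  · have hVn : Subtype.val '' (V : Set (levi α)) ∈ 𝓝[levi α] (1 : G) := by
      rw [nhdsWithin_eq_map_subtype_coe (one_mem (levi α))]
      exact image_mem_map (hV.isOpen.mem_nhds (one_mem V))
    exact inter_mem (nhdsWithin_mono 1 (hK.le_levi hKc) hVn) self_mem_nhdsWithin
  · rintro _ ⟨⟨x, hx, rfl⟩, -⟩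
    exact hVY hx

end Levi

section TidyAbove

variable {G : Type*} [Group G] [TopologicalSpace G] {α : G ≃ₜ* G} {B C H : Subgroup G}

/-- `α(B) ⊆ B α(B₊)`: the one-step form of Willis' condition `B = B₊B₋` of tidiness above, which
for compact `B` is equivalent to it. It lets a partial orbit in `B` be prolonged after a correction
from `B₊`. -/
def IsTidyAbove (α : G ≃ₜ* G) (B : Subgroup G) : Prop :=
  α '' B ⊆ (B : Set G) * α '' plus α B

theorem IsStable.isTidyAbove (hB : IsStable α B) : IsTidyAbove α B := by
  rintro _ ⟨b, hb, rfl⟩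
  exact ⟨α b, hB.apply_mem hb, α 1, ⟨1, one_mem _, rfl⟩, by simp⟩

theorem exists_forall_le_iter_mem (hB : IsTidyAbove α B) {v : ℕ → G}
    (hv : ∀ n, (v (n + 1))⁻¹ * α (v n) ∈ B) (n : ℕ) :
    ∃ u, ∀ j ≤ n, (v j)⁻¹ * iter α j u ∈ B := by
  induction n with
  | zero => exact ⟨v 0, fun j hj => by simp [Nat.le_zero.1 hj]⟩
  | succ n ih =>
    obtain ⟨u, hu⟩ := ih
    obtain ⟨b, hb, _, ⟨a, ha, rfl⟩, hba⟩ := hB ⟨_, hu n le_rfl, rfl⟩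
    simp only [map_mul, map_inv, apply_iter] at hba
    refine ⟨u * (iter α (-n) a)⁻¹, fun j hj => ?_⟩
    rw [map_mul, map_inv, ← iter_add_apply, ← mul_assoc]
    obtain hj | rfl := Nat.le_succ_iff.1 hj
    · exact mul_mem (hu j hj) (inv_mem (plus_le α B (iter_mem_plus_of_nonpos (by omega) ha)))
    · have hlast : (v (n + 1))⁻¹ * iter α (n + 1 : ℕ) u * (α a)⁻¹ =
          (v (n + 1))⁻¹ * α (v n) * b := by
        rw [eq_mul_inv_of_mul_eq hba, Nat.cast_succ]
        group
      rw [Nat.cast_succ, add_neg_cancel_comm, iter_one_apply, ← Nat.cast_succ, hlast]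
      exact mul_mem (hv n) hb

variable [IsTopologicalGroup G]

theorem exists_isTidyAbove_le [T2Space G] (hH : IsStable α H) (hCH : C ≤ H)
    (hCc : IsCompact (C : Set G)) (hC : (C : Set G) ∈ 𝓝[H] 1) :
    ∃ B ≤ C, IsCompact (B : Set G) ∧ (B : Set G) ∈ 𝓝[H] 1 ∧ IsTidyAbove α B := by
  have hPc : ∀ k, IsCompact (plusUpTo α C k : Set G) := fun k =>
    hCc.of_isClosed_subset (isClosed_plusUpTo hCc.isClosed k) (plusUpTo_le α C k)
  obtain ⟨O, hO, hO1, hOC⟩ := mem_nhdsWithin.1 hC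
  have hinter : ⋂ k, (plusUpTo α C k : Set G) ⊆ α ⁻¹' (O * α '' (plus α C : Set G)) := by
    rw [← Subgroup.coe_iInf, iInf_plusUpTo]
    exact fun x hx => ⟨1, hO1, α x, ⟨x, hx, rfl⟩, one_mul _⟩
  have hpre : IsOpen (α ⁻¹' (O * α '' (plus α C : Set G))) :=
    hO.mul_right.preimage (map_continuous α)
  obtain ⟨k, hk⟩ := exists_subset_nhds_of_isCompact
    (Antitone.directed_ge fun _ _ hkl => plusUpTo_antitone α C hkl) hPc
    fun x hx => hpre.mem_nhds (hinter hx)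
  refine ⟨plusUpTo α C k, plusUpTo_le α C k, hPc k, plusUpTo_mem_nhdsWithin hH hC k, ?_⟩
  rintro _ ⟨d, hd, rfl⟩
  obtain ⟨o, ho, _, ⟨a, ha, rfl⟩, hoa⟩ := hk hd
  have hda : d * a⁻¹ ∈ plusUpTo α C k :=
    mul_mem hd (inv_mem (plus_le α _ ((plus_plusUpTo α C k).symm ▸ ha)))
  have hαda : α (d * a⁻¹) = o := by
    rw [map_mul, map_inv, ← hoa, mul_inv_cancel_right]
  have hoC : o ∈ C :=
    hOC ⟨ho, hαda ▸ hH.apply_mem (hCH (plusUpTo_le α C k hda))⟩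
  rw [plus_plusUpTo]
  exact ⟨o, hαda ▸ apply_mem_plusUpTo hda (hαda.symm ▸ hoC), α a, ⟨a, ha, rfl⟩, hoa⟩

theorem exists_forall_iter_mem [T2Space G] (hBc : IsCompact (B : Set G)) (hB : IsTidyAbove α B)
    {v : ℕ → G} (hv : ∀ n, (v (n + 1))⁻¹ * α (v n) ∈ B) :
    ∃ u, ∀ n : ℕ, (v n)⁻¹ * iter α n u ∈ B := by
  let F : ℕ → Set G := fun n => ⋂ j ≤ n, (fun u => (v j)⁻¹ * iter α j u) ⁻¹' B
  have hFc : ∀ n, IsClosed (F n) := fun n => isClosed_biInter fun j _ =>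
    hBc.isClosed.preimage ((continuous_iter α j).const_mul _)
  have hF0 : IsCompact (F 0) := by
    refine (hBc.smul (v 0)).of_isClosed_subset (hFc 0) fun u hu => ?_
    have := Set.mem_iInter₂.1 hu 0 le_rfl
    simpa [Set.mem_smul_set_iff_inv_smul_mem] using this
  obtain ⟨u, hu⟩ := IsCompact.nonempty_iInter_of_sequence_nonempty_isCompact_isClosed F
    (fun n => Set.biInter_subset_biInter_left fun j hj => Nat.le_succ_of_le hj)
    (fun n => (exists_forall_le_iter_mem hB hv n).imp fun u hu => Set.mem_iInter₂.2 hu) hF0 hFc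
  exact ⟨u, fun n => Set.mem_iInter₂.1 (Set.mem_iInter.1 hu n) n le_rfl⟩

end TidyAbove

section ContractionModulo

variable {G : Type*} [Group G] [TopologicalSpace G] {α : G ≃ₜ* G} {H : Subgroup G}

theorem mem_contractionSetMod {S : Set G} {x : G} : x ∈ contractionSetMod α S ↔
    ∀ V ∈ 𝓝 (1 : G), ∀ᶠ n : ℕ in atTop, iter α n x ∈ V * S := by
  simp only [contractionSetMod, eventually_atTop, Set.mem_ofPred_eq]

theorem mul_mem_contractionSetMod (hH : IsStable α H) {x h : G}
    (hx : x ∈ contractionSetMod α (H : Set G)) (hh : h ∈ H) :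
    x * h ∈ contractionSetMod α (H : Set G) := by
  rw [mem_contractionSetMod] at hx ⊢
  intro V hV
  filter_upwards [hx V hV] with n hn
  obtain ⟨v, hv, k, hk, hvk⟩ := hn
  refine ⟨v, hv, k * iter α n h, mul_mem hk (hH.iter_mem n hh), ?_⟩
  rw [map_mul, ← hvk, mul_assoc]

theorem contractionSet_subset_contractionSetMod (α : G ≃ₜ* G) (H : Subgroup G) :
    contractionSet α ⊆ contractionSetMod α (H : Set G) := fun x hx =>
  mem_contractionSetMod.2 fun _ hV =>
    (Tendsto.eventually_mem hx hV).mono fun n hn => ⟨iter α n x, hn, 1, one_mem H, mul_one _⟩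

variable [IsTopologicalGroup G]

theorem exists_pseudoOrbit (hH : IsStable α H) {x : G}
    (hx : x ∈ contractionSetMod α (H : Set G)) {B V : Set G} (hB : B ∈ 𝓝[H] 1) (hV : V ∈ 𝓝 1) :
    ∃ (N : ℕ) (v : ℕ → G), ∀ n : ℕ, v n ∈ V ∧ (v n)⁻¹ * iter α (N + n) x ∈ H ∧
      (v (n + 1))⁻¹ * α (v n) ∈ B := by
  obtain ⟨O, hO, hO1, hOB⟩ := mem_nhdsWithin.1 hB
  have hcont : Tendsto (fun p : G × G => p.1⁻¹ * α p.2) (𝓝 1 ×ˢ 𝓝 1) (𝓝 1) := by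
    have : Continuous fun p : G × G => p.1⁻¹ * α p.2 := by fun_prop
    simpa [nhds_prod_eq] using this.tendsto (1, 1)
  obtain ⟨Y, hY, hYO⟩ := mem_prod_same_iff.1 (hcont (hO.mem_nhds hO1))
  obtain ⟨N, hN⟩ := hx (Y ∩ V) (inter_mem hY hV)
  choose v hv h hh hvh using fun n : ℕ => hN (N + n) (N.le_add_right n)
  have hvH : ∀ n : ℕ, (v n)⁻¹ * iter α (N + n) x ∈ H := fun n => by
    rw [← Nat.cast_add, ← hvh, inv_mul_cancel_left]
    exact hh n
  refine ⟨N, v, fun n => ⟨(hv n).2, hvH n, hOB ⟨hYO (Set.mk_mem_prod (hv _).1 (hv n).1), ?_⟩⟩⟩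
  have hstep := mul_mem (hvH (n + 1)) (inv_mem (hH.apply_mem (hvH n)))
  rw [map_mul, map_inv, apply_iter, Nat.cast_succ, add_assoc] at hstep
  simpa [mul_assoc] using hstep

theorem exists_mul_eventually_mem_mul [T2Space G] {B : Subgroup G} (hH : IsStable α H)
    (hBH : B ≤ H) (hBc : IsCompact (B : Set G)) (hBn : (B : Set G) ∈ 𝓝[H] 1)
    (hB : IsTidyAbove α B) {x : G} (hx : x ∈ contractionSetMod α (H : Set G)) {V : Set G}
    (hV : V ∈ 𝓝 1) : ∃ h ∈ H, ∀ᶠ n : ℕ in atTop, iter α n (x * h) ∈ V * (B : Set G) := by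
  obtain ⟨N, v, hv⟩ := exists_pseudoOrbit hH hx hBn hV
  obtain ⟨u, hu⟩ := exists_forall_iter_mem hBc hB fun n => (hv n).2.2
  have huH : (iter α N x)⁻¹ * u ∈ H := by
    have := mul_mem (inv_mem (hv 0).2.1) (hBH (hu 0))
    simpa using this
  refine ⟨iter α (-N) ((iter α N x)⁻¹ * u), hH.iter_mem _ huH, ?_⟩
  have hu' : iter α N (x * iter α (-N) ((iter α N x)⁻¹ * u)) = u := by
    rw [map_mul, iter_iter_neg, mul_inv_cancel_left]
  filter_upwards [eventually_ge_atTop N] with n hn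
  obtain ⟨m, rfl⟩ := Nat.exists_eq_add_of_le' hn
  rw [Nat.cast_add, iter_add_apply, hu']
  exact ⟨v m, (hv m).1, _, hu m, mul_inv_cancel_left _ _⟩

theorem mem_of_mapClusterPt_of_eventually_mem_mul {ι : Type*} {l : Filter ι} {f : ι → G}
    {S : Set G} (hS : IsClosed S) (hf : ∀ V ∈ 𝓝 (1 : G), ∀ᶠ i in l, f i ∈ V * S) {y : G}
    (hy : MapClusterPt y l f) : y ∈ S := by
  rw [← hS.closure_eq, mem_closure_iff_nhds]
  intro Z hZ
  have hcont : Tendsto (fun p : G × G => p.1⁻¹ * p.2) (𝓝 1 ×ˢ 𝓝 y) (𝓝 y) := by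
    have : Continuous fun p : G × G => p.1⁻¹ * p.2 := by fun_prop
    simpa [nhds_prod_eq] using this.tendsto (1, y)
  obtain ⟨V, hV, Z', hZ', hVZ⟩ := mem_prod_iff.1 (hcont hZ)
  obtain ⟨i, hiZ, v, hv, s, hs, hvs⟩ := ((hy.frequently hZ').and_eventually (hf V hV)).exists
  refine ⟨s, ?_, hs⟩
  have hmem : v⁻¹ * f i ∈ Z := hVZ (Set.mk_mem_prod hv hiZ)
  rwa [← hvs, inv_mul_cancel_left] at hmem

theorem mem_contractionSetMod_stableCore [T2Space G] {V : Subgroup G}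
    (hVc : IsCompact (V : Set G)) (hHc : IsClosed (H : Set G)) (hH : IsStable α H) {u : G}
    (hu : u ∈ contractionSetMod α (H : Set G)) (huV : ∀ᶠ n : ℕ in atTop, iter α n u ∈ V) :
    u ∈ contractionSetMod α (stableCore α (V ⊓ H) : Set G) := by
  have hcluster : ∀ y, MapClusterPt y atTop (fun n : ℕ => iter α n u) →
      y ∈ stableCore α (V ⊓ H) := by
    intro y hy
    have hyH : y ∈ H :=
      mem_of_mapClusterPt_of_eventually_mem_mul hHc (mem_contractionSetMod.1 hu) hy
    refine mem_stableCore.2 fun m => ⟨?_, hH.iter_mem m hyH⟩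
    refine hVc.isClosed.mem_of_mapClusterPt
      (hy.continuousAt_comp (continuous_iter α m).continuousAt) ?_
    obtain ⟨N, hN⟩ := eventually_atTop.1 huV
    filter_upwards [eventually_ge_atTop (N + m.natAbs)] with n hn
    obtain ⟨k, hk⟩ := Int.eq_ofNat_of_zero_le (a := m + n) (by omega)
    rw [Function.comp_apply, ← iter_add_apply, hk]
    exact hN k (by omega)
  rw [mem_contractionSetMod]
  intro Y hY
  obtain ⟨O, hOY, hO, hO1⟩ := mem_nhds_iff.1 hY
  by_contra hcon
  have hfreq : ∃ᶠ n : ℕ in atTop,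
      iter α n u ∈ (V : Set G) \ (O * (stableCore α (V ⊓ H) : Set G)) :=
    ((not_eventually.1 hcon).and_eventually huV).mono fun n hn =>
      ⟨hn.2, fun h => hn.1 (Set.mul_subset_mul_right hOY h)⟩
  obtain ⟨y, hy, hyc⟩ := (hVc.diff hO.mul_right).exists_mapClusterPt_of_frequently hfreq
  exact hy.2 ⟨1, hO1, y, hcluster y hyc, one_mul y⟩

end ContractionModulo

section CompactModulus

variable {G : Type*} [Group G] [TopologicalSpace G] [IsTopologicalGroup G] {α : G ≃ₜ* G}
  {K W : Subgroup G}

theorem isClosed_of_mul_subset (hK : IsClosed (K : Set G)) (hW : (W : Set G) ∈ 𝓝[K] 1)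
    {T : Set G} (hTK : T ⊆ K) (hTW : T * W ⊆ T) : IsClosed T := by
  refine isClosed_of_closure_subset fun x hx => ?_
  have hxK : x ∈ K := closure_minimal hTK hK hx
  have : (𝓝[T] x).NeBot := mem_closure_iff_nhdsWithin_neBot.1 hx
  have hlim : Tendsto (fun t => t⁻¹ * x) (𝓝[T] x) (𝓝[K] 1) := by
    refine tendsto_nhdsWithin_iff.2 ⟨?_, ?_⟩
    · have : Continuous fun t => t⁻¹ * x := by fun_prop
      simpa using (this.tendsto x).mono_left nhdsWithin_le_nhds
    · filter_upwards [self_mem_nhdsWithin] with t ht using mul_mem (inv_mem (hTK ht)) hxK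
  obtain ⟨t, htW, htT⟩ := ((hlim.eventually_mem hW).and self_mem_nhdsWithin).exists
  exact hTW ⟨t, htT, _, htW, mul_inv_cancel_left t x⟩

theorem IsStableNhd.isCompact [T2Space G] (hW : IsStableNhd α K W) (hKc : IsCompact (K : Set G)) :
    IsCompact (W : Set G) :=
  hKc.of_isClosed_subset
    (isClosed_of_mul_subset hKc.isClosed hW.mem_nhdsWithin hW.le (by simp)) hW.le

theorem IsStableNhd.isClosed_setOf_eventually_mem_mul (hW : IsStableNhd α K W)
    (hKc : IsClosed (K : Set G)) (u : G) (V : Set G) :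
    IsClosed {k | k ∈ K ∧ ∀ᶠ n : ℕ in atTop, iter α n (u * k) ∈ V * (W : Set G)} := by
  refine isClosed_of_mul_subset hKc hW.mem_nhdsWithin (fun k hk => hk.1) ?_
  rintro _ ⟨k, ⟨hk, hkev⟩, w, hw, rfl⟩
  refine ⟨mul_mem hk (hW.le hw), hkev.mono ?_⟩
  rintro n ⟨v, hv, w', hw', hvw⟩
  refine ⟨v, hv, w' * iter α n w, mul_mem hw' (hW.isStable.iter_mem n hw), ?_⟩
  rw [← mul_assoc u, map_mul, ← hvw, mul_assoc]

theorem exists_forall_eventually_mem_mul [T2Space G] (hKc : IsCompact (K : Set G))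
    (hK : IsStable α K) {u : G} (hu : u ∈ contractionSetMod α (K : Set G)) :
    ∃ k ∈ K, ∀ W, IsStableNhd α K W → ∀ V ∈ 𝓝 (1 : G),
      ∀ᶠ n : ℕ in atTop, iter α n (u * k) ∈ V * (W : Set G) := by
  let T : {W // IsStableNhd α K W} × {V : Set G // V ∈ 𝓝 1} → Set G := fun i =>
    {k | k ∈ K ∧ ∀ᶠ n : ℕ in atTop, iter α n (u * k) ∈ i.2.1 * (i.1.1 : Set G)}
  have : Nonempty ({W // IsStableNhd α K W} × {V : Set G // V ∈ 𝓝 1}) :=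
    ⟨⟨K, hK.isStableNhd_self⟩, ⟨Set.univ, univ_mem⟩⟩
  have hTc : ∀ i, IsClosed (T i) := fun i =>
    i.1.2.isClosed_setOf_eventually_mem_mul hKc.isClosed u i.2.1
  have hTne : ∀ i, (T i).Nonempty := by
    rintro ⟨⟨W, hW⟩, V, hV⟩
    exact exists_mul_eventually_mem_mul hK hW.le (hW.isCompact hKc) hW.mem_nhdsWithin
      hW.isStable.isTidyAbove hu hV
  have hTdir : Directed (· ⊇ ·) T := by
    rintro ⟨⟨W, hW⟩, V, hV⟩ ⟨⟨W', hW'⟩, V', hV'⟩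
    refine ⟨⟨⟨W ⊓ W', hW.inf hW'⟩, V ∩ V', inter_mem hV hV'⟩, ?_, ?_⟩
    · exact fun k hk => ⟨hk.1, hk.2.mono fun n hn =>
        Set.mul_subset_mul Set.inter_subset_left (fun _ h => h.1) hn⟩
    · exact fun k hk => ⟨hk.1, hk.2.mono fun n hn =>
        Set.mul_subset_mul Set.inter_subset_right (fun _ h => h.2) hn⟩
  obtain ⟨k, hk⟩ := IsCompact.nonempty_iInter_of_directed_nonempty_isCompact_isClosed T hTdir hTne
    (fun i => hKc.of_isClosed_subset (hTc i) fun k hk => hk.1) hTc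
  rw [Set.mem_iInter] at hk
  exact ⟨k, (hk (Classical.arbitrary _)).1, fun W hW V hV => (hk ⟨⟨W, hW⟩, V, hV⟩).2⟩

theorem exists_mul_mem_contractionSet [T2Space G] (hKc : IsCompact (K : Set G))
    (hK : IsStable α K)
    (hsmall : ∀ Y ∈ 𝓝 (1 : G), ∃ W : Subgroup G, IsStableNhd α K W ∧ (W : Set G) ⊆ Y) {u : G}
    (hu : u ∈ contractionSetMod α (K : Set G)) : ∃ k ∈ K, u * k ∈ contractionSet α := by
  obtain ⟨k, hk, hkW⟩ := exists_forall_eventually_mem_mul hKc hK hu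
  refine ⟨k, hk, fun Y hY => ?_⟩
  obtain ⟨V, hV, hVY⟩ := exists_nhds_one_split hY
  obtain ⟨W, hW, hWV⟩ := hsmall V hV
  filter_upwards [hkW W hW V hV] with n hn
  obtain ⟨v, hv, w, hw, hvw⟩ := hn
  exact hvw ▸ hVY v hv w (hWV hw)

end CompactModulus

section Reduction

variable {G : Type*} [Group G] [TopologicalSpace G] [IsTopologicalGroup G]

theorem exists_isOpen_isCompact_subgroup_subset {W : Set G} (hWc : IsCompact W) (hWo : IsOpen W)
    (hW1 : 1 ∈ W) :
    ∃ V : Subgroup G, IsOpen (V : Set G) ∧ IsCompact (V : Set G) ∧ (V : Set G) ⊆ W := by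
  obtain ⟨T, hT, hTW⟩ := compact_open_separated_mul_left hWc hWo subset_rfl
  have hVo : IsOpen (MulAction.stabilizer G W : Set G) := by
    refine Subgroup.isOpen_of_mem_nhds _ (g := 1) ?_
    filter_upwards [hT, inv_mem_nhds_one G hT] with g hg hg'
    have hsub : ∀ t ∈ T, t • W ⊆ W := fun t ht =>
      (Set.smul_set_subset_mul ht).trans hTW
    exact (hsub g hg).antisymm (Set.subset_smul_set_iff.2 (hsub g⁻¹ hg'))
  have hVW : (MulAction.stabilizer G W : Set G) ⊆ W := fun g hg => by
    simpa using (MulAction.mem_stabilizer_set.1 hg 1).2 hW1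
  exact ⟨_, hVo, hWc.of_isClosed_subset (Subgroup.isClosed_of_isOpen _ hVo) hVW, hVW⟩

theorem exists_isOpen_isCompact_subgroup (G : Type*) [Group G] [TopologicalSpace G]
    [IsTopologicalGroup G] [LocallyCompactSpace G] [TotallyDisconnectedSpace G] :
    ∃ V : Subgroup G, IsOpen (V : Set G) ∧ IsCompact (V : Set G) := by
  obtain ⟨C, hC, hC1⟩ := exists_compact_mem_nhds (1 : G)
  obtain ⟨W, hW, hW1, hWC⟩ := loc_compact_Haus_tot_disc_of_zero_dim.mem_nhds_iff.1 hC1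
  obtain ⟨V, hVo, hVc, -⟩ := exists_isOpen_isCompact_subgroup_subset
    (hC.of_isClosed_subset hW.isClosed hWC) hW.isOpen hW1
  exact ⟨V, hVo, hVc⟩

theorem exists_isCompact_mem_contractionSetMod [LocallyCompactSpace G] [TotallyDisconnectedSpace G]
    {α : G ≃ₜ* G} {H : Subgroup G} (hHc : IsClosed (H : Set G)) (hH : IsStable α H) {x : G}
    (hx : x ∈ contractionSetMod α (H : Set G)) :
    ∃ K ≤ H, IsCompact (K : Set G) ∧ IsStable α K ∧
      ∃ h ∈ H, x * h ∈ contractionSetMod α (K : Set G) := by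
  obtain ⟨V, hVo, hVc⟩ := exists_isOpen_isCompact_subgroup G
  have hVH : IsCompact ((V ⊓ H : Subgroup G) : Set G) := hVc.inter_right hHc
  have hVHn : ((V ⊓ H : Subgroup G) : Set G) ∈ 𝓝[H] 1 :=
    inter_mem (mem_nhdsWithin_of_mem_nhds (hVo.mem_nhds (one_mem V))) self_mem_nhdsWithin
  obtain ⟨B, hBVH, hBc, hBn, hB⟩ := exists_isTidyAbove_le hH inf_le_right hVH hVHn
  obtain ⟨h, hh, hxh⟩ := exists_mul_eventually_mem_mul hH (hBVH.trans inf_le_right) hBc hBn hB hx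
    (hVo.mem_nhds (one_mem V))
  have hxhV : ∀ᶠ n : ℕ in atTop, iter α n (x * h) ∈ V := hxh.mono fun n hn => by
    obtain ⟨v, hv, b, hb, hvb⟩ := hn
    exact hvb ▸ mul_mem hv (hBVH hb).1
  refine ⟨stableCore α (V ⊓ H), (stableCore_le α _).trans inf_le_right,
    hVH.of_isClosed_subset (isClosed_stableCore hVH.isClosed) (stableCore_le α _),
    isStable_stableCore α _, h, hh, ?_⟩
  exact mem_contractionSetMod_stableCore hVc hHc hH (mul_mem_contractionSetMod hH hx hh) hxhV

end Reduction

end TidyAut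

theorem lemma1 {G : Type*} [Group G] [TopologicalSpace G] [IsTopologicalGroup G]
    [LocallyCompactSpace G] [TotallyDisconnectedSpace G] (α : G ≃ₜ* G)
    (H : Subgroup G) (hHclosed : IsClosed (H : Set G)) (hHstable : TidyAut.IsStable α H)
    (htidy : TidyAut.IsTidy
      (TidyAut.restrict α (TidyAut.levi α) (TidyAut.isStable_levi α))) :
    TidyAut.contractionSetMod α (H : Set G) =
      TidyAut.contractionSet α * (H : Set G) := by
  open TidyAut in
  apply Set.Subset.antisymm
  · intro x hx
    obtain ⟨K, hKH, hKc, hK, h, hh, hxh⟩ :=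
      exists_isCompact_mem_contractionSetMod hHclosed hHstable hx
    obtain ⟨k, hk, hxhk⟩ := exists_mul_mem_contractionSet hKc hK
      (fun Y hY => exists_isStableNhd_subset htidy hKc hK hY) hxh
    exact ⟨x * h * k, hxhk, (h * k)⁻¹, inv_mem (mul_mem hh (hKH hk)), by group⟩
  · rintro _ ⟨u, hu, h, hh, rfl⟩
    exact mul_mem_contractionSetMod hHstable
      (contractionSet_subset_contractionSetMod α H hu) hh
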